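/- Let $d\ge 1$ be a fixed integer and let $V=\{x_1,\dots,x_n\}$ be a set of $n$ points independently and uniformly distributed in $[0,1]^d$. For a graph $G$ with vertex set $V$, let $B_i$ be the closed Euclidean ball centred at $x_i$ whose radius is the largest distance from $x_i$ to one of its neighbours in $G$ (zero if it has none); let $I(x,G)$ be the number of balls $B_1,\dots,B_n$ that contain the point $x$, and let $I(G)=\max_{x\in V}I(x,G)$. Let $I(V)$ be the minimum of $I(G)$ over all connected graphs $G$ with vertex set $V$. A minimum spanning tree of $V$ is a connected graph with vertex set $V$ whose total Euclidean edge length is minimum. There is a constant $C$, depending only on $d$, such that each of the following holds with probability tending to $1$ as $n\to\infty$: 1. every minimum spanning tree $T$ of $V$ satisfies $I(T)\le C(\log n)^{1/2}$; 2. if $d\in\{1,2\}$, then $I(V)\le C(\log n)^{1/3}$; 3. if $d\ge 3$, then $I(V)\le C(\log n)^{1/3}(\log\log n)^{1/2}$. -/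

import Mathlib

open MeasureTheory Filter Topology

/-- Euclidean `d`-space, with the Euclidean distance. -/
abbrev Pt (d : ℕ) : Type := EuclideanSpace ℝ (Fin d)

/-- The unit cube `[0,1]^d`. -/
def unitCube (d : ℕ) : Set (Pt d) := {p | ∀ k, p k ∈ Set.Icc (0 : ℝ) 1}

/-- The uniform distribution on `[0,1]^d`: Lebesgue measure restricted to the cube
(which has volume one). -/
noncomputable def uniformCube (d : ℕ) : Measure (Pt d) := volume.restrict (unitCube d)

instance uniformCube_isProbabilityMeasure (d : ℕ) : IsProbabilityMeasure (uniformCube d) := by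
  constructor
  have h : unitCube d = (MeasurableEquiv.toLp 2 (Fin d → ℝ)).symm ⁻¹'
      (Set.univ.pi fun _ => Set.Icc (0 : ℝ) 1) := by
    ext p
    simp only [unitCube, Set.mem_preimage, Set.mem_univ_pi, Set.mem_ofPred_eq]
    rfl
  rw [uniformCube, Measure.restrict_apply_univ, h,
    (EuclideanSpace.volume_preserving_symm_measurableEquiv_toLp (Fin d)).measure_preimage_equiv]
  rw [volume_pi, Measure.pi_pi]
  simp

/-- The law of `n` independent points, each uniformly distributed in `[0,1]^d`. -/
noncomputable def uniformPoints (d n : ℕ) : Measure (Fin n → Pt d) :=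
  Measure.pi fun _ => uniformCube d

section Interference

variable {d n : ℕ}

/-- The radius of the ball at the `i`-th point of the geometric graph `G` on `x 0, …, x (n-1)`:
the distance to the farthest neighbour (zero for an isolated vertex). -/
noncomputable def ballRadius (x : Fin n → Pt d) (G : SimpleGraph (Fin n)) (i : Fin n) : ℝ :=
  sSup ((fun j => dist (x i) (x j)) '' G.neighborSet i)

/-- `I(p, G)`: the number of balls that contain the point `p`. -/
noncomputable def interferenceAt (x : Fin n → Pt d) (G : SimpleGraph (Fin n)) (p : Pt d) : ℕ :=
  Set.ncard {i : Fin n | p ∈ Metric.closedBall (x i) (ballRadius x G i)}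

/-- `I(G)`: the maximum of `I(p, G)` over the vertices `p`. -/
noncomputable def graphInterference (x : Fin n → Pt d) (G : SimpleGraph (Fin n)) : ℕ :=
  Finset.univ.sup fun i => interferenceAt x G (x i)

/-- `I(V)`: the minimum of `I(G)` over the connected graphs `G` on the points. -/
noncomputable def pointInterference (x : Fin n → Pt d) : ℕ :=
  sInf (graphInterference x '' {G | G.Connected})

/-- For a nonempty family of points the minimum is attained by a connected graph. -/
theorem exists_graphInterference_eq [NeZero n] (x : Fin n → Pt d) :
    ∃ G : SimpleGraph (Fin n), G.Connected ∧ graphInterference x G = pointInterference x :=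
  Nat.sInf_mem (s := graphInterference x '' {G | G.Connected})
    ⟨_, ⊤, SimpleGraph.connected_top, rfl⟩

open Classical in
/-- The total Euclidean length of the edges. -/
noncomputable def totalLength (x : Fin n → Pt d) (G : SimpleGraph (Fin n)) : ℝ :=
  ∑ e ∈ G.edgeFinset, Sym2.lift ⟨fun i j => dist (x i) (x j), fun _ _ => dist_comm _ _⟩ e

/-- A minimum spanning tree: a connected graph of minimum total edge length.
(When the points are distinct, such a graph is a tree.) -/
def IsMST (x : Fin n → Pt d) (G : SimpleGraph (Fin n)) : Prop :=
  G.Connected ∧ ∀ H : SimpleGraph (Fin n), H.Connected → totalLength x G ≤ totalLength x H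

end Interference

/-- `A n` holds with high probability for `n` independent uniform points in `[0,1]^d`:
its probability tends to one as `n → ∞`. -/
def WithHighProbability (d : ℕ) (A : (n : ℕ) → (Fin n → Pt d) → Prop) : Prop :=
  Tendsto (fun n => uniformPoints d n {x | A n x}) atTop (𝓝 1)

/-! Suppose the points are `lam`-dense in the cube. Minimum spanning tree edges then have length at
most `2 * lam`, since the cube is connected. By the exchange property a point lies in boundedly many
balls with radius in `(r, 2 * r]`, so in `O(s)` balls of radius above `4 * lam / 2 ^ s`
(`exists_scales_bound`). Smaller balls come from centres very close to the point. With `t` about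
`(log n) ^ (1 / (b + 1))` and `s = 6 * t`, no ball of that tiny radius about a sample point holds
more than `t ^ b` points, with high probability: the expected number is at most `exp (-2 * t)`, so
the union bound gives `n * exp (-2 * t ^ (b + 1)) ≤ 1 / n`. The case `b = 1` bounds spanning trees.
For `b = 2`, a spanning tree is used only on a net at the tiny scale. Each cluster around a net
point has at most `t ^ 2` points, and `exists_hubs` finds `O(t)` hubs in it such that, with all
others joined to their nearest hub, a point lies in `O(t)` of their balls. The total is `O(s + t)`.
This works in every dimension, so the bound for `d ≥ 3` follows with room to spare. -/

/-! ### Packing and the selection of hubs. -/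

/-- Balls of radius `R * r` can be coloured with a number of colours depending only on `d` and `R`
so that points of equal colour are at distance less than `r`. -/
theorem exists_coloring (d : ℕ) (R : ℝ) : ∃ T : Finset (Pt d), ∀ (p : Pt d) (r : ℝ), 0 < r →
    ∃ col : Pt d → Pt d, (∀ x, dist x p ≤ R * r → col x ∈ T) ∧
      ∀ x y, dist x p ≤ R * r → dist y p ≤ R * r → col x = col y → dist x y < r := by
  -- After rescaling to `r = 1`, the colour of a point is the centre of a covering ball of radius `1
  -- / 2` that contains it.
  obtain ⟨T, hT, hc⟩ := Metric.totallyBounded_iff.1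
    (isCompact_closedBall (0 : Pt d) R).totallyBounded (1 / 2) (by norm_num)
  have key : ∀ (p : Pt d) (r : ℝ), 0 < r → ∀ x, dist x p ≤ R * r →
      ∃ y ∈ T, dist (r⁻¹ • (x - p)) y < 1 / 2 := by
    intro p r hr x hx
    have : r⁻¹ • (x - p) ∈ Metric.closedBall (0 : Pt d) R := by
      rw [mem_closedBall_zero_iff, norm_smul, Real.norm_of_nonneg (by positivity), ← dist_eq_norm,
        inv_mul_le_iff₀ hr, mul_comm]
      exact hx
    simpa using hc this
  refine ⟨hT.toFinset, fun p r hr => ?_⟩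
  choose! f hf hf' using key p r hr
  refine ⟨f, fun x hx => by simpa using hf x hx, fun x y hx hy hxy => ?_⟩
  have h1 := hf' x hx
  have h2 := hf' y hy
  rw [← hxy] at h2
  have h3 : dist (r⁻¹ • (x - p)) (r⁻¹ • (y - p)) < 1 := by
    linarith [dist_triangle_right (r⁻¹ • (x - p)) (r⁻¹ • (y - p)) (f x)]
  rw [dist_smul₀, Real.norm_of_nonneg (by positivity), dist_sub_right, inv_mul_lt_iff₀ hr,
    mul_one] at h3
  exact h3

/-- Among vectors with nearly equal directions, a long vector is closer to a shorter one than to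
the points near the origin. -/
theorem norm_sub_lt_of_direction {d : ℕ} {u v w : Pt d} {r : ℝ} (hr : 0 < r)
    (hu : 7 * r < ‖u‖) (huv : ‖u‖ ≤ ‖v‖) (hw : ‖w‖ ≤ 3 * r)
    (h : dist (‖u‖⁻¹ • u) (‖v‖⁻¹ • v) < 1 / 2) : dist v u < dist v w := by
  have hu0 : 0 < ‖u‖ := by linarith
  have hv0 : 0 < ‖v‖ := by linarith
  -- Travel from `v` radially to the sphere of radius `‖u‖`, then across it: the cost is at most
  -- `‖v‖ - ‖u‖ / 2`, and `‖u‖ / 2 > 3 * r ≥ ‖w‖`.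
  have e : v - u = (‖v‖ - ‖u‖) • (‖v‖⁻¹ • v) + ‖u‖ • (‖v‖⁻¹ • v - ‖u‖⁻¹ • u) := by
    rw [smul_sub, smul_inv_smul₀ hu0.ne', sub_smul, smul_inv_smul₀ hv0.ne']
    abel
  have h1 : dist v u ≤ (‖v‖ - ‖u‖) + ‖u‖ * (1 / 2) := by
    rw [dist_eq_norm, e]
    refine (norm_add_le _ _).trans (add_le_add ?_ ?_)
    · rw [norm_smul, norm_smul, norm_inv, norm_norm, inv_mul_cancel₀ hv0.ne', mul_one,
        Real.norm_of_nonneg (by linarith)]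
    · rw [norm_smul, norm_norm, ← dist_eq_norm, dist_comm]
      gcongr
  have h2 : ‖v‖ - ‖w‖ ≤ dist v w := by
    rw [dist_eq_norm]
    exact norm_sub_norm_le v w
  linarith

/-- A smallest ball centred at a point of `W` that contains at least `t` points of `W`. -/
theorem exists_smallest_ball {d : ℕ} {ι : Type*} (x : ι → Pt d) (W : Finset ι) {t : ℕ} (ht : 1 ≤ t)
    (hW : t ≤ W.card) : ∃ z ∈ W, ∃ r : ℝ, 0 ≤ r ∧ t ≤ (W.filter fun j => dist (x j) (x z) ≤ r).card ∧
      ∀ y ∈ W, (W.filter fun j => dist (x j) (x y) < r).card < t := by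
  classical
  have far : ∀ (z : ι) (A : Finset ι), A ⊆ W → t ≤ A.card → ∃ y ∈ A,
      t ≤ (W.filter fun j => dist (x j) (x z) ≤ dist (x y) (x z)).card := by
    intro z A hA hc
    obtain ⟨y, hy, hm⟩ := A.exists_max_image (fun y => dist (x y) (x z))
      (Finset.card_pos.1 (by omega))
    exact ⟨y, hy, hc.trans (Finset.card_le_card fun j hj =>
      Finset.mem_filter.2 ⟨hA hj, hm j hj⟩)⟩
  -- Only distances between points of `W` need be tried as radii: if an open ball holds `t` points,
  -- shrink it to the farthest of them.
  set D := (W ×ˢ W).filter fun q =>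
    t ≤ (W.filter fun j => dist (x j) (x q.1) ≤ dist (x q.2) (x q.1)).card with hD
  obtain ⟨z₀, hz₀⟩ : W.Nonempty := Finset.card_pos.1 (by omega)
  obtain ⟨y₀, hy₀, hc₀⟩ := far z₀ W subset_rfl hW
  obtain ⟨⟨z, y⟩, hq, hmin⟩ := D.exists_min_image (fun q => dist (x q.2) (x q.1))
    ⟨(z₀, y₀), by simp [hD, hz₀, hy₀, hc₀]⟩
  simp only [hD, Finset.mem_filter, Finset.mem_product] at hq hmin
  refine ⟨z, hq.1.1, _, dist_nonneg, hq.2, fun y' hy' => ?_⟩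
  by_contra! hcon
  obtain ⟨y'', h1, h2⟩ := far y' _ (Finset.filter_subset _ _) hcon
  rw [Finset.mem_filter] at h1
  have := hmin (y', y'') ⟨⟨hy', h1.1⟩, h2⟩
  simp only at this
  linarith [h1.2]

/-- Every finite set of points has a small set `H` of hubs such that no point `p` of space is closer
than all hubs to many of the points. -/
theorem exists_hubs (d : ℕ) : ∃ C : ℕ, ∀ {ι : Type} (x : ι → Pt d), Function.Injective x →
    ∀ t : ℕ, 2 ≤ t → ∀ S : Finset ι, ∃ H ⊆ S, H.card * t ≤ C * S.card ∧
      ∀ p : Pt d, (S.filter fun q => ∀ h ∈ H, dist (x q) p ≤ dist (x q) (x h)).card ≤ C * t := by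
  classical
  obtain ⟨T, hT⟩ := exists_coloring d 7
  obtain ⟨A, hA⟩ := exists_coloring d 2
  -- Radius `2 * (1 / 2) = 1`: `dir` splits the unit directions into classes of pairwise distance
  -- below `1 / 2`.
  obtain ⟨dir, hdirA, hdir⟩ := hA 0 (1 / 2) (by norm_num)
  refine ⟨T.card + A.card + 1, fun {ι} x hx t ht S => ?_⟩
  induction hk : S.card using Nat.strong_induction_on generalizing S with
  | _ k ih =>
  subst hk
  by_cases hS : S.card < t
  · refine ⟨∅, by simp, by simp, fun p => ?_⟩
    refine (Finset.card_filter_le _ _).trans ?_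
    nlinarith
  obtain ⟨z, hz, r, hr0, hzr, hball⟩ := exists_smallest_ball x S (by omega : 1 ≤ t) (not_lt.1 hS)
  have hr : 0 < r := by
    refine lt_of_le_of_ne hr0 fun h0 => ?_
    have : (S.filter fun j => dist (x j) (x z) ≤ r).card ≤ 1 := by
      refine Finset.card_le_one.2 fun a ha b hb => hx ?_
      simp only [← h0, Finset.mem_filter, dist_le_zero] at ha hb
      exact ha.2.trans hb.2.symm
    omega
  set B := S.filter fun j => dist (x j) (x z) ≤ r with hB
  have hBS : B ⊆ S := Finset.filter_subset _ _
  have hcard : (S \ B).card + B.card = S.card := Finset.card_sdiff_add_card_eq_card hBS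
  obtain ⟨H', hH'S, hH'c, hH'p⟩ := ih (S \ B).card (by omega) (S \ B) rfl
  -- directional hubs
  set cone : Pt d → Finset ι := fun c => S.filter fun j => 7 * r < dist (x j) (x z) ∧
    dir (‖x j - x z‖⁻¹ • (x j - x z)) = c with hcone
  have hnear : ∀ c, ∃ D : Finset ι, D ⊆ S ∧ D.card ≤ 1 ∧ ∀ q ∈ cone c, ∃ h ∈ D, h ∈ cone c ∧
      dist (x h) (x z) ≤ dist (x q) (x z) := by
    intro c
    by_cases hne : (cone c).Nonempty
    · obtain ⟨h, hh, hm⟩ := (cone c).exists_min_image (fun j => dist (x j) (x z)) hne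
      exact ⟨{h}, by simpa using (Finset.mem_filter.1 hh).1, by simp,
        fun q hq => ⟨h, by simp, hh, hm q hq⟩⟩
    · exact ⟨∅, by simp, by simp, fun q hq => (hne ⟨q, hq⟩).elim⟩
  choose D hDS hDc hD using hnear
  -- Removing `B` deletes at least `t` points and costs at most `A.card + 1` hubs, which pays for
  -- the bound on `H.card * t`.
  refine ⟨insert z (H' ∪ A.biUnion D), ?_, ?_, fun p => ?_⟩
  · refine Finset.insert_subset hz (Finset.union_subset (hH'S.trans Finset.sdiff_subset) ?_)
    exact Finset.biUnion_subset.2 fun c _ => hDS c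
  · have h1 : (insert z (H' ∪ A.biUnion D)).card ≤ H'.card + A.card + 1 := by
      refine (Finset.card_insert_le _ _).trans (Nat.add_le_add_right ?_ 1)
      refine (Finset.card_union_le _ _).trans (Nat.add_le_add_left ?_ _)
      simpa using Finset.card_biUnion_le_card_mul A D 1 fun c _ => hDc c
    calc _ ≤ (H'.card + A.card + 1) * t := Nat.mul_le_mul_right _ h1
      _ = H'.card * t + (A.card + 1) * t := by ring
      _ ≤ (T.card + A.card + 1) * (S \ B).card + (T.card + A.card + 1) * B.card :=
          add_le_add hH'c (Nat.mul_le_mul (by omega) hzr)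
      _ = _ := by rw [← mul_add, hcard]
  -- For `p` near `z`, a point beyond `7 * r` has the nearest point of its cone as a hub closer than
  -- `p`, so it is not counted.
  by_cases hp : dist p (x z) ≤ 3 * r
  · obtain ⟨col, hcolT, hcol⟩ := hT (x z) r hr
    have hsub : (S.filter fun q => ∀ h ∈ insert z (H' ∪ A.biUnion D),
        dist (x q) p ≤ dist (x q) (x h)) ⊆ S.filter fun q => dist (x q) (x z) ≤ 7 * r := by
      intro q hq
      rw [Finset.mem_filter] at hq ⊢
      refine ⟨hq.1, ?_⟩
      by_contra! hfar
      set c := dir (‖x q - x z‖⁻¹ • (x q - x z)) with hc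
      have hunit : ∀ j, dist (‖x j - x z‖⁻¹ • (x j - x z)) (0 : Pt d) ≤ 2 * (1 / 2) := by
        intro j
        rw [dist_zero_right, norm_smul, norm_inv, norm_norm]
        exact (inv_mul_le_one).trans (by norm_num)
      have hcA : c ∈ A := hdirA _ (hunit q)
      obtain ⟨h, hhD, hhc, hle⟩ := hD c q (Finset.mem_filter.2 ⟨hq.1, hfar, rfl⟩)
      have hhc' := (Finset.mem_filter.1 hhc).2
      have := norm_sub_lt_of_direction (u := x h - x z) (v := x q - x z) (w := p - x z) hr
        (by rw [← dist_eq_norm]; exact hhc'.1) (by rw [← dist_eq_norm, ← dist_eq_norm]; exact hle)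
        (by rw [← dist_eq_norm]; exact hp) (hdir _ _ (hunit h) (hunit q) hhc'.2)
      rw [dist_sub_right, dist_sub_right] at this
      have h2 := hq.2 h (by
        simp only [Finset.mem_insert, Finset.mem_union, Finset.mem_biUnion]
        exact Or.inr (Or.inr ⟨c, hcA, hhD⟩))
      linarith
    refine (Finset.card_le_card hsub).trans ?_
    -- Each colour class lies in the open ball of radius `r` about any of its members, and by
    -- minimality of `r` that ball has fewer than `t` points.
    calc _ ≤ t * T.card := by
          refine Finset.card_le_mul_card_image_of_maps_to (f := fun q => col (x q))
            (fun q hq => hcolT _ (Finset.mem_filter.1 hq).2) t fun c _ => ?_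
          obtain h0 | ⟨y, hy⟩ := ((S.filter fun q => dist (x q) (x z) ≤ 7 * r).filter
            fun q => col (x q) = c).eq_empty_or_nonempty
          · rw [h0]; simp
          · refine (Finset.card_le_card fun q hq => ?_).trans
              (hball y (Finset.mem_filter.1 (Finset.mem_filter.1 hy).1).1).le
            simp only [Finset.mem_filter] at hq hy ⊢
            exact ⟨hq.1.1, hcol _ _ hq.1.2 hy.1.2 (hq.2.trans hy.2.symm)⟩
      _ ≤ _ := by nlinarith
  -- For `p` far from `z`, every point of `B` is closer to the hub `z` than to `p`, so only `S \ B`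
  -- contributes.
  · refine (Finset.card_le_card fun q hq => ?_).trans (hH'p p)
    rw [Finset.mem_filter] at hq ⊢
    refine ⟨Finset.mem_sdiff.2 ⟨hq.1, fun hqB => ?_⟩, fun h hh => hq.2 h (by simp [hh])⟩
    have h1 := hq.2 z (by simp)
    have h2 := (Finset.mem_filter.1 hqB).2
    linarith [dist_triangle_left p (x z) (x q)]

/-! ### Minimum spanning trees: exchange, edge lengths and scales. -/

section

variable {d n : ℕ}

theorem ballRadius_le {x : Fin n → Pt d} {G : SimpleGraph (Fin n)} {i : Fin n} {r : ℝ} (hr : 0 ≤ r)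
    (h : ∀ j, G.Adj i j → dist (x i) (x j) ≤ r) : ballRadius x G i ≤ r :=
  Real.sSup_le (by rintro _ ⟨j, hj, rfl⟩; exact h j hj) hr

theorem dist_le_ballRadius {x : Fin n → Pt d} {G : SimpleGraph (Fin n)} {i j : Fin n}
    (h : G.Adj i j) : dist (x i) (x j) ≤ ballRadius x G i :=
  le_csSup (Set.toFinite _).bddAbove ⟨j, h, rfl⟩

theorem exists_dist_eq_ballRadius {x : Fin n → Pt d} {G : SimpleGraph (Fin n)} {i : Fin n}
    (h : 0 < ballRadius x G i) : ∃ j, G.Adj i j ∧ dist (x i) (x j) = ballRadius x G i := by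
  have hne : ((fun j => dist (x i) (x j)) '' G.neighborSet i).Nonempty := by
    by_contra hcon
    rw [Set.not_nonempty_iff_eq_empty] at hcon
    rw [ballRadius, hcon, Real.sSup_empty] at h
    exact h.false
  obtain ⟨j, hj, he⟩ := hne.csSup_mem (Set.toFinite _)
  exact ⟨j, hj, he⟩

/-- Every edge of positive length is a bridge, and no shorter pair reconnects the graph once the
edge is deleted. -/
def ExchangeProperty (x : Fin n → Pt d) (G : SimpleGraph (Fin n)) : Prop :=
  ∀ i j, G.Adj i j → 0 < dist (x i) (x j) →
    ¬ (G.deleteEdges {s(i, j)}).Reachable i j ∧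
      ∀ a b, dist (x a) (x b) < dist (x i) (x j) → (G.deleteEdges {s(i, j)}).Reachable a b

theorem SimpleGraph.Connected.reachable_deleteEdges {V : Type*} {G : SimpleGraph V}
    (hG : G.Connected) (i j v : V) :
    (G.deleteEdges {s(i, j)}).Reachable i v ∨ (G.deleteEdges {s(i, j)}).Reachable j v := by
  have h := (SimpleGraph.reachable_iff_reflTransGen i v).1 (hG.preconnected i v)
  induction h with
  | refl => exact Or.inl (SimpleGraph.Reachable.refl _)
  | @tail b c _ hbc ih =>
    by_cases he : s(b, c) = s(i, j)
    · rw [Sym2.eq_iff] at he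
      rcases he with ⟨-, rfl⟩ | ⟨-, rfl⟩
      · exact Or.inr (SimpleGraph.Reachable.refl _)
      · exact Or.inl (SimpleGraph.Reachable.refl _)
    · have hadj : (G.deleteEdges {s(i, j)}).Adj b c := by
        rw [SimpleGraph.deleteEdges_adj]
        exact ⟨hbc, he⟩
      exact ih.imp (·.trans hadj.reachable) (·.trans hadj.reachable)

theorem totalLength_add_le {x : Fin n → Pt d} {G H : SimpleGraph (Fin n)} {i j : Fin n}
    (hij : G.Adj i j) (a b : Fin n)
    (h : ∀ e ∈ H.edgeSet, e ∈ (G.deleteEdges {s(i, j)}).edgeSet ∨ e = s(a, b)) :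
    totalLength x H + dist (x i) (x j) ≤ totalLength x G + dist (x a) (x b) := by
  classical
  unfold totalLength
  set w : Sym2 (Fin n) → ℝ :=
    Sym2.lift ⟨fun i j => dist (x i) (x j), fun _ _ => dist_comm _ _⟩ with hw
  have hw0 : ∀ e, 0 ≤ w e := fun e => by
    induction e using Sym2.ind with
    | _ u v => exact dist_nonneg (x := x u) (y := x v)
  have h1 : ∀ E : Finset (Sym2 (Fin n)), E = G.edgeFinset → w s(i, j) + ∑ e ∈ E.erase s(i, j), w e
      = ∑ e ∈ E, w e := fun E hE => Finset.add_sum_erase _ _ (by subst hE; simpa using hij)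
  have h2 := h1 _ rfl
  have h3 : ∑ e ∈ H.edgeFinset, w e ≤ ∑ e ∈ insert s(a, b) (G.edgeFinset.erase s(i, j)), w e := by
    refine Finset.sum_le_sum_of_subset_of_nonneg (fun e he => ?_) fun e _ _ => hw0 e
    rw [SimpleGraph.mem_edgeFinset] at he
    rw [Finset.mem_insert, Finset.mem_erase, SimpleGraph.mem_edgeFinset]
    rcases h e he with h | h
    · rw [SimpleGraph.edgeSet_deleteEdges] at h
      exact Or.inr ⟨h.2, h.1⟩
    · exact Or.inl h
  have h4 : ∑ e ∈ insert s(a, b) (G.edgeFinset.erase s(i, j)), w e ≤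
      w s(a, b) + ∑ e ∈ G.edgeFinset.erase s(i, j), w e := by
    by_cases hm : s(a, b) ∈ G.edgeFinset.erase s(i, j)
    · rw [Finset.insert_eq_of_mem hm]
      linarith [hw0 s(a, b)]
    · rw [Finset.sum_insert hm]
  have e1 : w s(i, j) = dist (x i) (x j) := rfl
  have e2 : w s(a, b) = dist (x a) (x b) := rfl
  linarith

theorem IsMST.exchangeProperty {x : Fin n → Pt d} {G : SimpleGraph (Fin n)} (hG : IsMST x G) :
    ExchangeProperty x G := by
  intro i j hij hpos
  set D := G.deleteEdges {s(i, j)} with hD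
  have hor := hG.1.reachable_deleteEdges i j
  have : Nonempty (Fin n) := ⟨i⟩
  constructor
  · intro hr
    have hc : D.Connected := by
      refine SimpleGraph.connected_iff_exists_forall_reachable _ |>.2 ⟨i, fun v => ?_⟩
      exact (hor v).elim id hr.trans
    have h1 := hG.2 D hc
    -- The loop `s(i, i)` has weight zero, so this is the case of deleting without replacement.
    have h2 := totalLength_add_le (x := x) (H := D) hij i i fun e he => Or.inl he
    rw [dist_self] at h2
    linarith
  · intro a b hab
    by_contra hr
    set H := D ⊔ SimpleGraph.edge a b with hH
    have hne : a ≠ b := fun h => hr (h ▸ SimpleGraph.Reachable.refl _)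
    have hDH : D ≤ H := le_sup_left
    have hadj : H.Adj a b := by
      rw [hH, SimpleGraph.sup_adj, SimpleGraph.edge_adj]
      exact Or.inr ⟨Or.inl ⟨rfl, rfl⟩, hne⟩
    have hijr : H.Reachable i j := by
      rcases hor a with ha | ha <;> rcases hor b with hb | hb
      · exact (hr (ha.symm.trans hb)).elim
      · exact ((ha.mono hDH).trans hadj.reachable).trans (hb.mono hDH).symm
      · exact ((hb.mono hDH).trans hadj.reachable.symm).trans (ha.mono hDH).symm
      · exact (hr (ha.symm.trans hb)).elim
    have hc : H.Connected := by
      refine SimpleGraph.connected_iff_exists_forall_reachable _ |>.2 ⟨i, fun v => ?_⟩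
      exact (hor v).elim (·.mono hDH) fun h => hijr.trans (h.mono hDH)
    have h1 := hG.2 H hc
    have h2 := totalLength_add_le (x := x) (H := H) hij a b fun e => by
      induction e using Sym2.ind with
      | _ u v =>
        rw [SimpleGraph.mem_edgeSet, SimpleGraph.mem_edgeSet, hH, SimpleGraph.sup_adj,
          SimpleGraph.edge_adj, Sym2.eq_iff]
        tauto
    linarith

theorem exists_isMST (x : Fin n → Pt d) (hn : 0 < n) : ∃ G, IsMST x G := by
  have : Nonempty (Fin n) := ⟨⟨0, hn⟩⟩
  obtain ⟨G, hG, hmin⟩ := Set.exists_min_image {G : SimpleGraph (Fin n) | G.Connected}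
    (totalLength x) (Set.toFinite _) ⟨⊤, SimpleGraph.connected_top⟩
  exact ⟨G, hG, hmin⟩

theorem convex_unitCube (d : ℕ) : Convex ℝ (unitCube d) := by
  intro p hp q hq a b ha hb hab k
  exact convex_Icc (0 : ℝ) 1 (hp k) (hq k) ha hb hab

/-- The edges of a minimum spanning tree of a `lam`-dense set have length at most `2 * lam`. -/
theorem ExchangeProperty.dist_le {x : Fin n → Pt d} {G : SimpleGraph (Fin n)}
    (hG : ExchangeProperty x G) (hx : ∀ i, x i ∈ unitCube d) {lam : ℝ} (hlam : 0 ≤ lam)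
    (hdense : ∀ p ∈ unitCube d, ∃ i, dist p (x i) ≤ lam) {i j : Fin n} (hij : G.Adj i j) :
    dist (x i) (x j) ≤ 2 * lam := by
  by_contra! hlt
  obtain ⟨hnr, hr⟩ := hG i j hij (by linarith)
  set D := G.deleteEdges {s(i, j)}
  have hcl : ∀ A : Set (Fin n), IsClosed (⋃ a ∈ A, Metric.closedBall (x a) lam) := fun A =>
    (Set.toFinite A).isClosed_biUnion fun _ _ => Metric.isClosed_closedBall
  have hmem : ∀ (A : Set (Fin n)) a, a ∈ A → x a ∈ ⋃ a ∈ A, Metric.closedBall (x a) lam :=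
    fun A a ha => Set.mem_biUnion ha (Metric.mem_closedBall_self hlam)
  -- The balls about the two sides of the deleted edge form two closed sets covering the connected
  -- cube. They meet at some `c`, giving a pair across the cut at distance at most `2 * lam`.
  obtain ⟨c, -, hcA, hcB⟩ := isPreconnected_closed_iff.1 (convex_unitCube d).isPreconnected
    _ _ (hcl {v | D.Reachable i v}) (hcl {v | ¬ D.Reachable i v})
    (fun p hp => by
      obtain ⟨v, hv⟩ := hdense p hp
      by_cases h : D.Reachable i v
      · exact Or.inl (Set.mem_biUnion (show v ∈ {v | D.Reachable i v} from h) hv)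
      · exact Or.inr (Set.mem_biUnion (show v ∈ {v | ¬ D.Reachable i v} from h) hv))
    ⟨x i, hx i, hmem _ _ (SimpleGraph.Reachable.refl _)⟩ ⟨x j, hx j, hmem _ _ hnr⟩
  simp only [Set.mem_iUnion, exists_prop] at hcA hcB
  obtain ⟨a, ha, hca⟩ := hcA
  obtain ⟨b, hb, hcb⟩ := hcB
  rw [Metric.mem_closedBall] at hca hcb
  refine hb (SimpleGraph.Reachable.trans ha (hr a b ?_))
  linarith [dist_triangle_left (x a) (x b) c]

end

/-- A point lies in boundedly many balls of a minimum spanning tree at each scale. -/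
theorem exists_scale_bound (d : ℕ) : ∃ M : ℕ, ∀ {n : ℕ} (x : Fin n → Pt d) (G : SimpleGraph (Fin n)),
    ExchangeProperty x G → ∀ (p : Pt d) (r : ℝ), 0 < r →
      (Finset.univ.filter fun i => dist p (x i) ≤ ballRadius x G i ∧ r < ballRadius x G i ∧
        ballRadius x G i ≤ 2 * r).card ≤ M := by
  classical
  obtain ⟨T, hT⟩ := exists_coloring d 4
  refine ⟨(T ×ˢ T).card, fun {n} x G hG p r hr => ?_⟩
  obtain ⟨col, hcolT, hcol⟩ := hT p r hr
  set F := Finset.univ.filter fun i => dist p (x i) ≤ ballRadius x G i ∧ r < ballRadius x G i ∧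
        ballRadius x G i ≤ 2 * r with hF
  have hex : ∀ i ∈ F, ∃ j, G.Adj i j ∧ dist (x i) (x j) = ballRadius x G i := fun i hi =>
    exists_dist_eq_ballRadius (hr.trans (Finset.mem_filter.1 hi).2.2.1)
  choose! f hf hfd using hex
  have h1 : ∀ i ∈ F, dist (x i) p ≤ 4 * r ∧ dist (x (f i)) p ≤ 4 * r ∧ r < dist (x i) (x (f i)) := by
    intro i hi
    have h := (Finset.mem_filter.1 hi).2
    have := hfd i hi
    refine ⟨by rw [dist_comm]; linarith, ?_, by linarith⟩
    linarith [dist_triangle_left (x (f i)) p (x i), dist_comm p (x i)]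
  by_contra! hlt
  -- By pigeonhole, two radius-realising edges have both pairs of corresponding endpoints closer
  -- than `r`. The exchange property then reconnects the first edge through the second.
  obtain ⟨a, ha, b, hb, hab, he⟩ := Finset.exists_ne_map_eq_of_card_lt_of_maps_to hlt
    (f := fun i => (col (x i), col (x (f i)))) fun i hi =>
      Finset.mem_product.2 ⟨hcolT _ (h1 i hi).1, hcolT _ (h1 i hi).2.1⟩
  rw [Prod.mk.injEq] at he
  have d1 := hcol _ _ (h1 a ha).1 (h1 b hb).1 he.1
  have d2 := hcol _ _ (h1 a ha).2.1 (h1 b hb).2.1 he.2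
  have hla := (h1 a ha).2.2
  obtain ⟨hnr, hr'⟩ := hG a (f a) (hf a ha) (by linarith)
  refine hnr ((hr' a b (d1.trans hla)).trans (SimpleGraph.Reachable.trans
    (SimpleGraph.Adj.reachable ?_) (hr' (f a) (f b) (d2.trans hla)).symm))
  rw [SimpleGraph.deleteEdges_adj]
  -- The second edge could only be the first one reversed, but then `a` and `b` would be more than
  -- `r` apart.
  refine ⟨hf b hb, fun h => ?_⟩
  rw [Set.mem_singleton_iff, Sym2.eq_iff] at h
  rcases h with h | h
  · exact hab h.1.symm
  · rw [h.1] at d1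
    linarith

theorem exists_scales_bound (d : ℕ) : ∃ M : ℕ, ∀ {n : ℕ} (x : Fin n → Pt d)
    (G : SimpleGraph (Fin n)), ExchangeProperty x G → ∀ (ρ : ℝ) (s : ℕ), 0 < ρ →
    (∀ i, ballRadius x G i ≤ ρ * 2 ^ s) → ∀ p : Pt d,
      (Finset.univ.filter fun i => dist p (x i) ≤ ballRadius x G i ∧ ρ < ballRadius x G i).card
        ≤ M * s := by
  classical
  obtain ⟨M, hM⟩ := exists_scale_bound d
  refine ⟨M, fun {n} x G hG ρ s hρ hs p => ?_⟩
  have key : ∀ s : ℕ, (Finset.univ.filter fun i => dist p (x i) ≤ ballRadius x G i ∧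
      ρ < ballRadius x G i ∧ ballRadius x G i ≤ ρ * 2 ^ s).card ≤ M * s := by
    intro s
    induction s with
    | zero =>
      rw [Finset.filter_eq_empty_iff.2 fun i _ h => by linarith [h.2.1, h.2.2]]
      simp
    | succ s ih =>
      refine (Finset.card_le_card (t := _ ∪ _) fun i hi => ?_).trans
        ((Finset.card_union_le _ _).trans (add_le_add ih (hM x G hG p (ρ * 2 ^ s) (by positivity))))
      simp only [Finset.mem_union, Finset.mem_filter, Finset.mem_univ, true_and] at hi ⊢
      rcases le_or_gt (ballRadius x G i) (ρ * 2 ^ s) with h | h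
      · exact Or.inl ⟨hi.1, hi.2.1, h⟩
      · exact Or.inr ⟨hi.1, h, by rw [pow_succ] at hi; linarith [hi.2.2]⟩
  refine (Finset.card_le_card fun i hi => ?_).trans (key s)
  simp only [Finset.mem_filter, Finset.mem_univ, true_and] at hi ⊢
  exact ⟨hi.1, hi.2, hs i⟩

theorem interferenceAt_eq_card {d n : ℕ} (x : Fin n → Pt d) (G : SimpleGraph (Fin n)) (p : Pt d) :
    interferenceAt x G p =
      (Finset.univ.filter fun i => dist p (x i) ≤ ballRadius x G i).card := by
  rw [interferenceAt, ← Set.ncard_coe_finset]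
  congr 1
  ext i
  simp [Metric.mem_closedBall]

/-- Interference of a minimum spanning tree of a dense set without small crowded balls. -/
theorem exists_mst_interference_bound (d : ℕ) : ∃ M : ℕ, ∀ {n : ℕ} (x : Fin n → Pt d) (lam : ℝ)
    (s m : ℕ), 0 < lam → (∀ i, x i ∈ unitCube d) →
    (∀ p ∈ unitCube d, ∃ i, dist p (x i) ≤ lam) →
    (∀ i, (Finset.univ.filter fun j => dist (x j) (x i) ≤ 4 * lam / 2 ^ s).card ≤ m) →
    ∀ G, IsMST x G → graphInterference x G ≤ M * s + m := by
  classical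
  obtain ⟨M, hM⟩ := exists_scales_bound d
  refine ⟨M, fun {n} x lam s m hlam hx hdense hm G hG => Finset.sup_le fun i _ => ?_⟩
  rw [interferenceAt_eq_card]
  have h1 := hM x G hG.exchangeProperty (4 * lam / 2 ^ s) s (by positivity) (fun j => by
    rw [div_mul_cancel₀ _ (by positivity)]
    refine ballRadius_le (by positivity) fun k hk => ?_
    linarith [hG.exchangeProperty.dist_le hx hlam.le hdense hk]) (x i)
  refine (Finset.card_le_card (t := _ ∪ _) fun j hj => ?_).trans
    ((Finset.card_union_le _ _).trans (add_le_add h1 (hm i)))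
  simp only [Finset.mem_union, Finset.mem_filter, Finset.mem_univ, true_and] at hj ⊢
  -- A small ball contains `x i` only if its centre is among the at most `m` points crowding `x i`.
  rcases le_or_gt (ballRadius x G j) (4 * lam / 2 ^ s) with h | h
  · exact Or.inr (by rw [dist_comm]; linarith)
  · exact Or.inl ⟨hj, h⟩

/-! ### Nets, clusters and the low-interference graph. -/

/-- A separated set of maximum cardinality covers: an uncovered point could be added to it. -/
theorem exists_separated_net {d n : ℕ} (x : Fin n → Pt d) {δ : ℝ} (hδ : 0 ≤ δ) :
    ∃ N : Finset (Fin n), (∀ a ∈ N, ∀ b ∈ N, dist (x a) (x b) ≤ δ → a = b) ∧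
      ∀ i, ∃ w ∈ N, dist (x i) (x w) ≤ δ := by
  classical
  obtain ⟨N, hN, hmax⟩ := (Finset.univ.filter fun N : Finset (Fin n) =>
    ∀ a ∈ N, ∀ b ∈ N, dist (x a) (x b) ≤ δ → a = b).exists_max_image Finset.card
      ⟨∅, by simp⟩
  simp only [Finset.mem_filter, Finset.mem_univ, true_and] at hN hmax
  refine ⟨N, hN, fun i => ?_⟩
  by_contra! hcon
  have hi : i ∉ N := fun h => by
    have := hcon i h
    rw [dist_self] at this
    linarith
  have := hmax (insert i N) (by
    intro a ha b hb hab
    rw [Finset.mem_insert] at ha hb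
    rcases ha with rfl | ha <;> rcases hb with rfl | hb
    · rfl
    · linarith [hcon b hb]
    · rw [dist_comm] at hab
      linarith [hcon a ha]
    · exact hN a ha b hb hab)
  rw [Finset.card_insert_of_notMem hi] at this
  omega

theorem exists_separated_card_bound (d : ℕ) : ∃ M : ℕ, ∀ {n : ℕ} (x : Fin n → Pt d) (δ : ℝ),
    0 < δ → ∀ N : Finset (Fin n), (∀ a ∈ N, ∀ b ∈ N, dist (x a) (x b) ≤ δ → a = b) →
    ∀ p : Pt d, (N.filter fun w => dist p (x w) ≤ 2 * δ).card ≤ M := by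
  classical
  obtain ⟨T, hT⟩ := exists_coloring d 2
  refine ⟨T.card, fun {n} x δ hδ N hN p => ?_⟩
  obtain ⟨col, hcolT, hcol⟩ := hT p δ hδ
  refine Finset.card_le_card_of_injOn (fun w => col (x w)) (fun w hw => ?_) fun a ha b hb h => ?_
  · refine hcolT _ ?_
    rw [dist_comm]
    exact (Finset.mem_filter.1 hw).2
  · have ha := Finset.mem_filter.1 ha
    have hb := Finset.mem_filter.1 hb
    exact hN a ha.1 b hb.1 (hcol _ _ (by rw [dist_comm]; exact ha.2)
      (by rw [dist_comm]; exact hb.2) h).le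

/-- A dense set without small crowded balls has a connected graph of low interference: the clusters
around a net are joined to hubs, and the net carries a minimum spanning tree. -/
theorem exists_pointInterference_bound (d : ℕ) : ∃ C : ℕ, ∀ {n : ℕ} (x : Fin n → Pt d) (lam : ℝ)
    (s t : ℕ), 0 < n → Function.Injective x → 0 < lam → 2 ≤ t → (∀ i, x i ∈ unitCube d) →
    (∀ p ∈ unitCube d, ∃ i, dist p (x i) ≤ lam) →
    (∀ i, (Finset.univ.filter fun j => dist (x j) (x i) ≤ 4 * lam / 2 ^ s).card ≤ t ^ 2) →
    pointInterference x ≤ C * (s + t) := by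
  classical
  obtain ⟨C, hC⟩ := exists_hubs d
  obtain ⟨M, hM⟩ := exists_separated_card_bound d
  obtain ⟨M', hM'⟩ := exists_scales_bound d
  refine ⟨2 * M * C + M + M', fun {n} x lam s t hn hinj hlam ht hx hdense hcard => ?_⟩
  set δ := 4 * lam / 2 ^ s with hδdef
  have hδ : 0 < δ := by positivity
  have hδs : δ * 2 ^ s = 4 * lam := div_mul_cancel₀ _ (by positivity)
  have hδ4 : δ ≤ 4 * lam := div_le_self (by positivity) (one_le_pow₀ (by norm_num))
  obtain ⟨N, hN, hcov⟩ := exists_separated_net x hδ.le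
  choose c hcN hcδ using hcov
  have hcw : ∀ w ∈ N, c w = w := fun w hw => (hN w hw _ (hcN w) (hcδ w)).symm
  -- hubs of the clusters
  set S : Fin n → Finset (Fin n) := fun w => Finset.univ.filter fun i => c i = w with hS
  have hSt : ∀ w, (S w).card ≤ t ^ 2 := fun w => by
    refine (Finset.card_le_card fun i hi => ?_).trans (hcard w)
    simp only [hS, Finset.mem_filter, Finset.mem_univ, true_and] at hi ⊢
    exact hi ▸ hcδ i
  choose H hHS hHc hHp using fun w => hC x hinj t ht (S w)
  have hHt : ∀ w, (H w).card ≤ C * t := fun w => by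
    have h : (H w).card * t ≤ (C * t) * t :=
      (hHc w).trans ((Nat.mul_le_mul_left C (hSt w)).trans_eq (by ring))
    exact Nat.le_of_mul_le_mul_right h (by omega)
  have hHmem : ∀ w, ∀ h ∈ H w, c h = w := fun w h hh => by
    simpa [hS] using hHS w hh
  have hnearest : ∀ i, ∃ h ∈ insert (c i) (H (c i)), ∀ h' ∈ insert (c i) (H (c i)),
      dist (x i) (x h) ≤ dist (x i) (x h') := fun i =>
    Finset.exists_min_image _ (fun h => dist (x i) (x h)) (Finset.insert_nonempty _ _)
  choose g hg hgmin using hnearest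
  set hub : Fin n → Prop := fun i => i ∈ insert (c i) (H (c i)) with hhub
  have hcg : ∀ i, c (g i) = c i := fun i => by
    rcases Finset.mem_insert.1 (hg i) with h | h
    · rw [h, hcw _ (hcN i)]
    · exact hHmem _ _ h
  have hgh : ∀ i, hub (g i) := fun i => by
    simp only [hhub, hcg]
    exact hg i
  have hch : ∀ i, hub (c i) := fun i => by
    simp only [hhub, hcw _ (hcN i)]
    exact Finset.mem_insert_self _ _
  -- Two-level stars: a non-hub hangs on its nearest hub, a hub on its cluster centre.
  set π : Fin n → Fin n := fun i => if hub i then c i else g i with hπ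
  have hπh : ∀ i, hub (π i) := fun i => by
    simp only [hπ]
    split_ifs
    · exact hch i
    · exact hgh i
  have hπδ : ∀ i, dist (x i) (x (π i)) ≤ δ := fun i => by
    simp only [hπ]
    split_ifs
    · exact hcδ i
    · exact (hgmin i _ (Finset.mem_insert_self _ _)).trans (hcδ i)
  -- a minimum spanning tree of the net
  set f : Fin N.card ↪ Fin n :=
    N.equivFin.symm.toEmbedding.trans (Function.Embedding.subtype _) with hf
  have hfN : ∀ a, f a ∈ N := fun a => (N.equivFin.symm a).2
  have hfsurj : ∀ w ∈ N, ∃ a, f a = w := fun w hw => ⟨N.equivFin ⟨w, hw⟩, by simp [hf]⟩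
  have hNpos : 0 < N.card := Finset.card_pos.2 ⟨_, hcN ⟨0, hn⟩⟩
  obtain ⟨T, hT⟩ := exists_isMST (x ∘ f) hNpos
  -- The net is `(lam + δ)`-dense and `δ ≤ 4 * lam`, so its tree edges are at most `10 * lam ≤ 16 *
  -- lam`: two extra scales.
  have hTrad : ∀ a, ballRadius (x ∘ f) T a ≤ δ * 2 ^ (s + 2) := fun a => by
    refine ballRadius_le (by positivity) fun b hab => ?_
    refine (hT.exchangeProperty.dist_le (lam := lam + δ) (fun i => hx _) (by positivity)
      (fun p hp => ?_) hab).trans ?_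
    · obtain ⟨i, hi⟩ := hdense p hp
      obtain ⟨a, ha⟩ := hfsurj _ (hcN i)
      refine ⟨a, ?_⟩
      rw [Function.comp, ha]
      linarith [dist_triangle p (x i) (x (c i)), hcδ i]
    · rw [pow_add, ← mul_assoc, hδs]
      linarith
  set G : SimpleGraph (Fin n) := T.map f ⊔ SimpleGraph.fromRel (fun i j => j = π i) with hG
  have hadjπ : ∀ i, G.Reachable i (π i) := fun i => by
    by_cases h : i = π i
    · rw [← h]
    · refine SimpleGraph.Adj.reachable ?_
      rw [hG, SimpleGraph.sup_adj, SimpleGraph.fromRel_adj]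
      exact Or.inr ⟨h, Or.inl rfl⟩
  have hreachc : ∀ i, G.Reachable i (c i) := fun i => by
    by_cases h : hub i
    · simpa [hπ, h] using hadjπ i
    · have h1 := hadjπ i
      have h2 := hadjπ (g i)
      simp only [hπ, h, hgh, if_true, if_false, hcg] at h1 h2
      exact h1.trans h2
  have hconn : G.Connected := by
    refine SimpleGraph.connected_iff_exists_forall_reachable _ |>.2 ⟨c ⟨0, hn⟩, fun v => ?_⟩
    refine SimpleGraph.Reachable.trans ?_ (hreachc v).symm
    obtain ⟨a, ha⟩ := hfsurj _ (hcN ⟨0, hn⟩)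
    obtain ⟨b, hb⟩ := hfsurj _ (hcN v)
    rw [← ha, ← hb]
    exact ((hT.1.preconnected a b).map (SimpleGraph.Embedding.map f T).toHom).mono le_sup_left
  refine (Nat.sInf_le ⟨G, hconn, rfl⟩ : pointInterference x ≤ graphInterference x G).trans ?_
  refine Finset.sup_le fun i _ => ?_
  rw [interferenceAt_eq_card]
  set p := x i
  -- radii of the balls
  have hadj : ∀ i j, G.Adj i j → (∃ a b, T.Adj a b ∧ f a = i ∧ f b = j) ∨ j = π i ∨ i = π j := by
    intro i j h
    rw [hG, SimpleGraph.sup_adj, SimpleGraph.fromRel_adj, SimpleGraph.map_adj] at h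
    exact h.imp_right And.right
  have hrad_star : ∀ j, j ∉ N → ballRadius x G j ≤ δ := fun j hj => by
    refine ballRadius_le hδ.le fun k hk => ?_
    rcases hadj j k hk with ⟨a, b, -, rfl, -⟩ | rfl | rfl
    · exact (hj (hfN a)).elim
    · exact hπδ j
    · rw [dist_comm]; exact hπδ k
  -- A non-hub is a leaf. Its ball reaches `p` only if `p` is no farther than every hub of its
  -- cluster, which is the situation `exists_hubs` counts.
  have hrad_nonhub : ∀ j, ¬ hub j → ballRadius x G j ≤ dist (x j) (x (g j)) := fun j hj => by
    refine ballRadius_le dist_nonneg fun k hk => ?_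
    rcases hadj j k hk with ⟨a, b, -, rfl, -⟩ | h | h
    · refine (hj ?_).elim
      have := hch (f a)
      rwa [hcw _ (hfN a)] at this
    · simp [h, hπ, hj]
    · exact (hj (h ▸ hπh k)).elim
  have hrad_net : ∀ a, ballRadius x G (f a) ≤ max δ (ballRadius (x ∘ f) T a) := fun a => by
    refine ballRadius_le (le_max_of_le_left hδ.le) fun k hk => ?_
    rcases hadj _ k hk with ⟨a', b, hab, haa, rfl⟩ | rfl | h
    · rw [f.injective haa] at hab
      exact le_max_of_le_right (dist_le_ballRadius (x := x ∘ f) hab)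
    · exact le_max_of_le_left (hπδ _)
    · refine le_max_of_le_left ?_
      rw [h, dist_comm]
      exact hπδ k
  set W := N.filter fun w => dist p (x w) ≤ 2 * δ with hW
  have hWM : W.card ≤ M := hM x δ hδ N hN p
  -- Four kinds of balls reach `p`: non-hubs and hubs of the boundedly many clusters near `p`, net
  -- points with small radius, and net points whose radius comes from a long tree edge.
  have hcover : (Finset.univ.filter fun j => dist p (x j) ≤ ballRadius x G j) ⊆
      ((W.biUnion fun w => (S w).filter fun q => ∀ h ∈ H w, dist (x q) p ≤ dist (x q) (x h)) ∪
        W.biUnion H) ∪ (W ∪ (Finset.univ.filter fun a => dist p ((x ∘ f) a) ≤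
          ballRadius (x ∘ f) T a ∧ δ < ballRadius (x ∘ f) T a).map f) := by
    intro j hj
    have hj := (Finset.mem_filter.1 hj).2
    rw [Finset.mem_union, Finset.mem_union, Finset.mem_union, Finset.mem_biUnion,
      Finset.mem_biUnion, Finset.mem_map]
    by_cases hjN : j ∈ N
    · right
      obtain ⟨a, rfl⟩ := hfsurj j hjN
      rcases le_or_gt (ballRadius x G (f a)) δ with hle | hlt
      · exact Or.inl (Finset.mem_filter.2 ⟨hjN, by linarith⟩)
      · have := (le_max_iff.1 (hrad_net a)).resolve_left (not_le.2 hlt)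
        exact Or.inr ⟨a, Finset.mem_filter.2 ⟨Finset.mem_univ _, hj.trans this,
          hlt.trans_le this⟩, rfl⟩
    · left
      have hcW : c j ∈ W := by
        refine Finset.mem_filter.2 ⟨hcN j, ?_⟩
        linarith [hrad_star j hjN, hcδ j, dist_triangle p (x j) (x (c j))]
      by_cases hjh : hub j
      · refine Or.inr ⟨c j, hcW, (Finset.mem_insert.1 hjh).resolve_left fun h => hjN ?_⟩
        rw [h]
        exact hcN j
      · refine Or.inl ⟨c j, hcW, Finset.mem_filter.2 ⟨by simp [hS], fun h hh => ?_⟩⟩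
        rw [dist_comm]
        exact (hj.trans (hrad_nonhub j hjh)).trans (hgmin j h (Finset.mem_insert_of_mem hh))
  have h1 := Finset.card_biUnion_le_card_mul W
    (fun w => (S w).filter fun q => ∀ h ∈ H w, dist (x q) p ≤ dist (x q) (x h)) (C * t)
    fun w _ => by convert hHp w p
  have h2 := Finset.card_biUnion_le_card_mul W H (C * t) fun w _ => hHt w
  have h3 := hM' (x ∘ f) T hT.exchangeProperty δ (s + 2) hδ hTrad p
  have h4 := (Finset.card_le_card hcover).trans ((Finset.card_union_le _ _).trans
    (add_le_add ((Finset.card_union_le _ _).trans (add_le_add h1 h2))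
      ((Finset.card_union_le _ _).trans (add_le_add hWM ((Finset.card_map _).trans_le h3)))))
  refine h4.trans ?_
  have h5 : W.card * (C * t) ≤ M * (C * t) := Nat.mul_le_mul_right _ hWM
  have h6 : M' * (s + 2) ≤ M' * (s + t) := Nat.mul_le_mul_left _ (by omega)
  have h7 : M * (C * t) ≤ M * (C * (s + t)) :=
    Nat.mul_le_mul_left _ (Nat.mul_le_mul_left _ (by omega))
  have h8 : M ≤ M * (s + t) := Nat.le_mul_of_pos_right _ (by omega)
  calc _ ≤ M * (C * (s + t)) + M * (C * (s + t)) + (M * (s + t) + M' * (s + t)) := by omega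
    _ = _ := by ring

/-! ### Probability estimates: crowding and covering. -/

theorem volume_box {d : ℕ} (a b : Fin d → ℝ) :
    volume {p : Pt d | ∀ k, p k ∈ Set.Icc (a k) (b k)} = ∏ k, ENNReal.ofReal (b k - a k) := by
  have h : {p : Pt d | ∀ k, p k ∈ Set.Icc (a k) (b k)} =
      (MeasurableEquiv.toLp 2 (Fin d → ℝ)).symm ⁻¹' (Set.univ.pi fun k => Set.Icc (a k) (b k)) := by
    ext p
    simp only [Set.mem_preimage, Set.mem_univ_pi, Set.mem_ofPred_eq]
    rfl
  rw [h, (EuclideanSpace.volume_preserving_symm_measurableEquiv_toLp (Fin d)).measure_preimage_equiv,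
    volume_pi, Measure.pi_pi]
  simp

theorem isClosed_box {d : ℕ} (a b : Fin d → ℝ) :
    IsClosed {p : Pt d | ∀ k, p k ∈ Set.Icc (a k) (b k)} := by
  simp only [Set.ofPred_forall]
  refine isClosed_iInter fun k => isClosed_Icc.preimage ?_
  exact (EuclideanSpace.proj (𝕜 := ℝ) k).continuous

theorem dist_apply_le {d : ℕ} (p q : Pt d) (k : Fin d) : |p k - q k| ≤ dist p q := by
  rw [dist_eq_norm, ← Real.norm_eq_abs]
  exact PiLp.norm_apply_le (p - q) k

theorem uniformCube_closedBall_le {d : ℕ} (p : Pt d) (ρ : ℝ) :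
    uniformCube d (Metric.closedBall p ρ) ≤ ENNReal.ofReal (2 * ρ) ^ d := by
  refine (Measure.restrict_apply_le _ _).trans ?_
  calc volume (Metric.closedBall p ρ)
      ≤ volume {q : Pt d | ∀ k, q k ∈ Set.Icc (p k - ρ) (p k + ρ)} := measure_mono fun q hq k => by
        have := (dist_apply_le q p k).trans hq
        rw [abs_le] at this
        exact ⟨by linarith, by linarith⟩
    _ = ENNReal.ofReal (2 * ρ) ^ d := by
        rw [volume_box, Finset.prod_congr rfl fun k _ => by
          rw [show p k + ρ - (p k - ρ) = 2 * ρ by ring], Finset.prod_const, Finset.card_univ,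
          Fintype.card_fin]

/-- Conditioned on the centre `x i`, the other points fall in its ball independently; Fubini then
integrates the product bound. -/
theorem uniformPoints_ball_le {d n : ℕ} (i : Fin (n + 1)) (T : Finset (Fin n)) (ρ : ℝ) :
    uniformPoints d (n + 1) {x | ∀ j ∈ T, dist (x (i.succAbove j)) (x i) ≤ ρ} ≤
      (ENNReal.ofReal (2 * ρ) ^ d) ^ T.card := by
  have hmp := measurePreserving_piFinSuccAbove (fun _ : Fin (n + 1) => uniformCube d) i
  set A : Set (Pt d × (Fin n → Pt d)) := {q | ∀ j ∈ T, dist (q.2 j) q.1 ≤ ρ} with hA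
  have hAm : MeasurableSet A := by
    refine IsClosed.measurableSet ?_
    simp only [hA, Set.ofPred_forall]
    refine isClosed_iInter fun j => isClosed_iInter fun _ => isClosed_le ?_ continuous_const
    fun_prop
  have hpre : {x : Fin (n + 1) → Pt d | ∀ j ∈ T, dist (x (i.succAbove j)) (x i) ≤ ρ} =
      (MeasurableEquiv.piFinSuccAbove (fun _ => Pt d) i) ⁻¹' A := rfl
  rw [uniformPoints, hpre, hmp.measure_preimage hAm.nullMeasurableSet, Measure.prod_apply hAm]
  calc _ ≤ ∫⁻ _, (ENNReal.ofReal (2 * ρ) ^ d) ^ T.card ∂(uniformCube d) := by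
        refine lintegral_mono fun p => ?_
        have hsec : Prod.mk p ⁻¹' A =
            Set.univ.pi fun j => if j ∈ T then Metric.closedBall p ρ else Set.univ := by
          ext y
          simp only [hA, Set.mem_preimage, Set.mem_ofPred_eq, Set.mem_univ_pi]
          refine forall_congr' fun j => ?_
          split_ifs with h <;> simp [h]
        rw [hsec, Measure.pi_pi]
        calc _ ≤ ∏ j, if j ∈ T then ENNReal.ofReal (2 * ρ) ^ d else 1 := by
              refine Finset.prod_le_prod' fun j _ => ?_
              split_ifs
              · exact uniformCube_closedBall_le p ρ
              · exact prob_le_one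
          _ = _ := by
              rw [Finset.prod_ite_mem, Finset.univ_inter, Finset.prod_const]
    _ = _ := by simp

/-- The probability that some point has more than `m` points (itself included) within `ρ`. -/
theorem uniformPoints_crowded_le (d n m : ℕ) (ρ : ℝ) :
    uniformPoints d n {x | ∃ i, m < (Finset.univ.filter fun j => dist (x j) (x i) ≤ ρ).card} ≤
      n * (n * ENNReal.ofReal (2 * ρ) ^ d) ^ m := by
  obtain _ | n := n
  · simp
  have hsub : {x : Fin (n + 1) → Pt d |
      ∃ i, m < (Finset.univ.filter fun j => dist (x j) (x i) ≤ ρ).card} ⊆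
      ⋃ i ∈ (Finset.univ : Finset (Fin (n + 1))), ⋃ T ∈ Finset.powersetCard m Finset.univ,
        {x | ∀ j ∈ T, dist (x (Fin.succAbove i j)) (x i) ≤ ρ} := by
    rintro x ⟨i, hi⟩
    -- The centre counts itself, so more than `m` points means at least `m` others; the union bound
    -- runs over `m`-subsets of those.
    have hc : m ≤ (Finset.univ.filter fun j => dist (x (i.succAbove j)) (x i) ≤ ρ).card := by
      have : (Finset.univ.filter fun j => dist (x j) (x i) ≤ ρ) ⊆
          insert i ((Finset.univ.filter fun j => dist (x (i.succAbove j)) (x i) ≤ ρ).map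
            i.succAboveEmb) := by
        intro j hj
        rcases Fin.eq_self_or_eq_succAbove i j with rfl | ⟨k, rfl⟩
        · exact Finset.mem_insert_self _ _
        · refine Finset.mem_insert_of_mem (Finset.mem_map.2 ⟨k, ?_, rfl⟩)
          simpa using hj
      have h2 := (Finset.card_le_card this).trans (Finset.card_insert_le _ _)
      rw [Finset.card_map] at h2
      omega
    obtain ⟨T, hT, hTc⟩ := Finset.exists_subset_card_eq hc
    simp only [Set.mem_iUnion]
    exact ⟨i, Finset.mem_univ _, T, Finset.mem_powersetCard.2 ⟨Finset.subset_univ _, hTc⟩,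
      fun j hj => (Finset.mem_filter.1 (hT hj)).2⟩
  refine (measure_mono hsub).trans ((measure_biUnion_finset_le _ _).trans ?_)
  calc _ ≤ ∑ _i : Fin (n + 1), ((n + 1 : ℕ) * ENNReal.ofReal (2 * ρ) ^ d) ^ m := by
        refine Finset.sum_le_sum fun i _ => (measure_biUnion_finset_le _ _).trans ?_
        calc _ ≤ ∑ T ∈ Finset.powersetCard m (Finset.univ : Finset (Fin n)),
              (ENNReal.ofReal (2 * ρ) ^ d) ^ m := by
              refine Finset.sum_le_sum fun T hT => (uniformPoints_ball_le i T ρ).trans_eq ?_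
              rw [(Finset.mem_powersetCard.1 hT).2]
          _ = (n.choose m : ENNReal) * (ENNReal.ofReal (2 * ρ) ^ d) ^ m := by
              rw [Finset.sum_const, Finset.card_powersetCard, Finset.card_univ, Fintype.card_fin,
                nsmul_eq_mul]
          _ ≤ _ := by
              rw [mul_pow]
              gcongr
              exact_mod_cast (Nat.choose_le_pow n m).trans (Nat.pow_le_pow_left n.le_succ m)
    _ = _ := by simp

instance uniformPoints_isProbabilityMeasure (d n : ℕ) :
    IsProbabilityMeasure (uniformPoints d n) := by
  unfold uniformPoints
  infer_instance

/-- A coincidence is crowding with `m = 1` and `ρ = 0`, and `0 ^ d = 0` because `d ≥ 1`. -/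
theorem uniformPoints_not_injective {d : ℕ} (hd : 1 ≤ d) (n : ℕ) :
    uniformPoints d n {x | ¬ Function.Injective x} = 0 := by
  refine le_antisymm ((measure_mono fun x hx => ?_).trans
    ((uniformPoints_crowded_le d n 1 0).trans_eq ?_)) zero_le
  · simp only [Function.Injective, not_forall] at hx
    obtain ⟨a, b, hab, hne⟩ := hx
    exact ⟨b, Finset.one_lt_card.2 ⟨a, by simp [hab], b, by simp, hne⟩⟩
  · simp [show d ≠ 0 by omega]

theorem uniformPoints_not_mem_cube (d n : ℕ) :
    uniformPoints d n {x | ¬ ∀ i, x i ∈ unitCube d} = 0 := by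
  have hcube : unitCube d = {p : Pt d | ∀ k, p k ∈ Set.Icc (0 : ℝ) 1} := rfl
  have h : ∀ᵐ x ∂(uniformPoints d n), ∀ i, x i ∈ unitCube d := by
    refine ae_all_iff.2 fun i => ?_
    refine (measurePreserving_eval (fun _ : Fin n => uniformCube d) i).quasiMeasurePreserving.ae ?_
    refine ae_restrict_mem ?_
    rw [hcube]
    exact (isClosed_box (fun _ => 0) (fun _ => 1)).measurableSet
  exact h

/-- The grid cell of side `1 / K` with index `c`. -/
def gridCell (d K : ℕ) (c : Fin d → Fin K) : Set (Pt d) :=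
  {p | ∀ k, p k ∈ Set.Icc ((c k : ℝ) / K) (((c k : ℝ) + 1) / K)}

theorem measurableSet_gridCell {d K : ℕ} (c : Fin d → Fin K) : MeasurableSet (gridCell d K c) :=
  (isClosed_box (fun k => (c k : ℝ) / K) (fun k => ((c k : ℝ) + 1) / K)).measurableSet

theorem uniformCube_gridCell {d K : ℕ} (c : Fin d → Fin K) :
    uniformCube d (gridCell d K c) = ENNReal.ofReal ((1 / K : ℝ) ^ d) := by
  have hsub : gridCell d K c ⊆ unitCube d := fun p hp k => by
    have hK : (0 : ℝ) < K := by exact_mod_cast (c k).pos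
    have h1 : ((c k : ℝ) + 1) / K ≤ 1 := by
      rw [div_le_one hK]
      exact_mod_cast (c k).is_lt
    exact ⟨(by positivity : (0 : ℝ) ≤ (c k : ℝ) / K).trans (hp k).1, (hp k).2.trans h1⟩
  rw [uniformCube, Measure.restrict_apply (measurableSet_gridCell c),
    Set.inter_eq_left.2 hsub, gridCell, volume_box, Finset.prod_congr rfl fun k _ => by
      rw [← sub_div, add_sub_cancel_left], Finset.prod_const, Finset.card_univ, Fintype.card_fin,
    ENNReal.ofReal_pow (by positivity)]

theorem uniformPoints_gridCell_empty_le {d K n : ℕ} (c : Fin d → Fin K) :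
    uniformPoints d n {x | ∀ i, x i ∉ gridCell d K c} ≤
      ENNReal.ofReal (Real.exp (-(n * (1 / K : ℝ) ^ d))) := by
  have h : {x : Fin n → Pt d | ∀ i, x i ∉ gridCell d K c} =
      Set.univ.pi fun _ => (gridCell d K c)ᶜ := by
    ext x
    simp
  rw [h, uniformPoints, Measure.pi_pi, Finset.prod_const, Finset.card_univ, Fintype.card_fin,
    prob_compl_eq_one_sub (measurableSet_gridCell c), uniformCube_gridCell,
    ← mul_neg, Real.exp_nat_mul, ENNReal.ofReal_pow (Real.exp_nonneg _)]
  gcongr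
  rw [← ENNReal.ofReal_one, ← ENNReal.ofReal_sub _ (by positivity)]
  exact ENNReal.ofReal_le_ofReal (by linarith [Real.add_one_le_exp (-(1 / K : ℝ) ^ d)])

theorem exists_dist_le_of_gridCell {d K n : ℕ} (hK : 0 < K) {x : Fin n → Pt d}
    (hx : ∀ c, ∃ i, x i ∈ gridCell d K c) : ∀ p ∈ unitCube d, ∃ i, dist p (x i) ≤ d / K := by
  intro p hp
  have hK' : (0 : ℝ) < K := by exact_mod_cast hK
  have hcell : ∀ k, ∃ c : Fin K, p k ∈ Set.Icc ((c : ℝ) / K) (((c : ℝ) + 1) / K) := by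
    intro k
    obtain ⟨h0, h1⟩ := hp k
    have h0' : 0 ≤ p k * K := by positivity
    -- The floor gives index `K` at coordinate `1`, which belongs to the last closed cell instead.
    rcases h1.lt_or_eq with h1 | h1
    · refine ⟨⟨⌊p k * K⌋₊, (Nat.floor_lt h0').2 (by nlinarith)⟩, ?_, ?_⟩
      · rw [div_le_iff₀ hK']
        exact Nat.floor_le h0'
      · rw [le_div_iff₀ hK']
        exact (Nat.lt_floor_add_one _).le
    · refine ⟨⟨K - 1, by omega⟩, ?_⟩
      simp only [h1, Nat.cast_sub (show 1 ≤ K by omega), Nat.cast_one, sub_add_cancel]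
      exact ⟨by rw [div_le_one hK']; linarith, by rw [div_self hK'.ne']⟩
  choose c hc using hcell
  obtain ⟨i, hi⟩ := hx c
  refine ⟨i, ?_⟩
  rw [EuclideanSpace.dist_eq]
  have hs : ∀ k, dist (p k) (x i k) ^ 2 ≤ (1 / K : ℝ) ^ 2 := fun k => by
    have h := Real.dist_le_of_mem_Icc (hc k) (hi k)
    rw [← sub_div, add_sub_cancel_left] at h
    exact pow_le_pow_left₀ dist_nonneg h 2
  rw [Real.sqrt_le_iff]
  refine ⟨by positivity, (Finset.sum_le_sum fun k _ => hs k).trans ?_⟩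
  rw [Finset.sum_const, Finset.card_univ, Fintype.card_fin, nsmul_eq_mul, div_pow, div_pow, one_pow,
    mul_one_div]
  gcongr
  exact_mod_cast Nat.le_self_pow two_ne_zero d

theorem uniformPoints_not_dense_le {d K n : ℕ} (hK : 0 < K) :
    uniformPoints d n {x | ¬ ∀ p ∈ unitCube d, ∃ i, dist p (x i) ≤ d / K} ≤
      ENNReal.ofReal (K ^ d * Real.exp (-(n * (1 / K : ℝ) ^ d))) := by
  have hsub : {x : Fin n → Pt d | ¬ ∀ p ∈ unitCube d, ∃ i, dist p (x i) ≤ d / K} ⊆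
      ⋃ c ∈ (Finset.univ : Finset (Fin d → Fin K)), {x | ∀ i, x i ∉ gridCell d K c} := by
    intro x hx
    by_contra hcon
    refine hx (exists_dist_le_of_gridCell hK fun c => ?_)
    simp only [Set.mem_iUnion, not_exists] at hcon
    simpa using hcon c (Finset.mem_univ _)
  refine (measure_mono hsub).trans ((measure_biUnion_finset_le _ _).trans
    ((Finset.sum_le_sum fun c _ => uniformPoints_gridCell_empty_le c).trans_eq ?_))
  rw [Finset.sum_const, Finset.card_univ, Fintype.card_fun, Fintype.card_fin, Fintype.card_fin,
    nsmul_eq_mul, ENNReal.ofReal_mul (by positivity)]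
  congr 1
  rw [← Nat.cast_pow, ENNReal.ofReal_natCast]

/-- Subadditivity of the outer measure suffices, so no event needs to be shown measurable. -/
theorem withHighProbability_of_compl_le {d : ℕ} {A : (n : ℕ) → (Fin n → Pt d) → Prop}
    {ε : ℕ → ENNReal} (hε : Tendsto ε atTop (𝓝 0))
    (h : ∀ᶠ n in atTop, uniformPoints d n {x | ¬ A n x} ≤ ε n) : WithHighProbability d A := by
  have h1 : Tendsto (fun n => 1 - ε n) atTop (𝓝 1) := by
    simpa using ENNReal.Tendsto.sub (tendsto_const_nhds (x := (1 : ENNReal))) hε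
      (Or.inl ENNReal.one_ne_top)
  refine tendsto_of_tendsto_of_tendsto_of_le_of_le' h1 tendsto_const_nhds ?_
    (Eventually.of_forall fun n => prob_le_one)
  filter_upwards [h] with n hn
  rw [tsub_le_iff_right]
  calc (1 : ENNReal) = uniformPoints d n ({x | A n x} ∪ {x | ¬ A n x}) := by
        rw [show ({x | A n x} ∪ {x | ¬ A n x}) = Set.univ from
          Set.eq_univ_of_forall fun x => em (A n x), measure_univ]
    _ ≤ _ := (measure_union_le _ _).trans (by gcongr)

theorem WithHighProbability.mono {d : ℕ} {A B : (n : ℕ) → (Fin n → Pt d) → Prop}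
    (hA : WithHighProbability d A) (h : ∀ᶠ n in atTop, ∀ x, A n x → B n x) :
    WithHighProbability d B := by
  refine tendsto_of_tendsto_of_tendsto_of_le_of_le' hA tendsto_const_nhds ?_
    (Eventually.of_forall fun n => prob_le_one)
  filter_upwards [h] with n hn
  exact measure_mono fun x hx => hn x hx

/-! ### Choice of scales and conclusion. -/

theorem tendsto_log_natCast : Tendsto (fun n : ℕ => Real.log n) atTop atTop :=
  Real.tendsto_log_atTop.comp tendsto_natCast_atTop_atTop

theorem tendsto_log_rpow {a : ℝ} (ha : 0 < a) :
    Tendsto (fun n : ℕ => Real.log n ^ a) atTop atTop :=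
  (tendsto_rpow_atTop ha).comp tendsto_log_natCast

/-- With `y = (log n) ^ (1 / (b + 1))` the left side is `c * y ^ (b + 1)`. This absorbs the factor
`log n` lost in passing from the mean spacing to the covering radius. -/
theorem eventually_mul_log_le_exp (c : ℝ) (b : ℕ) : ∀ᶠ n : ℕ in atTop,
    c * Real.log n ≤ Real.exp (Real.log n ^ (((b + 1 : ℕ) : ℝ)⁻¹)) := by
  have h1 : Tendsto (fun y : ℝ => c * (y ^ (b + 1) * Real.exp (-y))) atTop (𝓝 0) := by
    simpa using (Real.tendsto_pow_mul_exp_neg_atTop_nhds_zero (b + 1)).const_mul c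
  have h2 := (h1.comp (tendsto_log_rpow (a := ((b + 1 : ℕ) : ℝ)⁻¹) (by positivity))).eventually
    (eventually_le_nhds (zero_lt_one' ℝ))
  filter_upwards [h2, tendsto_log_natCast.eventually_ge_atTop 0] with n hn hL
  rw [Function.comp, Real.rpow_inv_natCast_pow hL (by omega), ← mul_assoc, Real.exp_neg,
    ← div_eq_mul_inv, div_le_one (Real.exp_pos _)] at hn
  exact hn

/-- The typical configurations: every point of the cube is within `lam n` of the points, and no ball
of a much smaller radius is crowded. -/
theorem exists_withHighProbability_dense_sparse {d : ℕ} (hd : 1 ≤ d) (b : ℕ) :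
    ∃ lam : ℕ → ℝ, (∀ᶠ n in atTop, 0 < lam n) ∧ WithHighProbability d fun n x =>
      Function.Injective x ∧ (∀ i, x i ∈ unitCube d) ∧
      (∀ p ∈ unitCube d, ∃ i, dist p (x i) ≤ lam n) ∧
      ∀ i, (Finset.univ.filter fun j => dist (x j) (x i) ≤
        4 * lam n / 2 ^ (6 * ⌈Real.log n ^ (((b + 1 : ℕ) : ℝ)⁻¹)⌉₊)).card ≤
          ⌈Real.log n ^ (((b + 1 : ℕ) : ℝ)⁻¹)⌉₊ ^ b := by
  -- Cells of volume at least `2 * log n / n` are each empty with probability at most `n⁻²`, and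
  -- there are at most `n` of them.
  set X : ℕ → ℝ := fun n => (n / (2 * Real.log n)) ^ ((d : ℝ)⁻¹) with hX
  set K : ℕ → ℕ := fun n => ⌊X n⌋₊ with hK
  have hev : ∀ᶠ n : ℕ in atTop, 1 ≤ Real.log n ∧ 2 * Real.log n ≤ n := by
    filter_upwards [tendsto_log_natCast.eventually_ge_atTop 1,
      tendsto_natCast_atTop_atTop.eventually
        (Real.isLittleO_log_id_atTop.bound (show (0 : ℝ) < 1 / 2 by norm_num))] with n h1 h2
    refine ⟨h1, ?_⟩
    rw [Real.norm_of_nonneg (by linarith), id, Real.norm_of_nonneg (by positivity)] at h2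
    linarith
  have hd0 : d ≠ 0 := by omega
  have hfacts : ∀ᶠ n : ℕ in atTop, 1 ≤ Real.log n ∧ (0 : ℝ) < n ∧ 0 < K n ∧
      (K n : ℝ) ^ d ≤ n / (2 * Real.log n) ∧ (1 / K n : ℝ) ^ d ≤ 2 ^ d * (2 * Real.log n / n) := by
    filter_upwards [hev] with n hn
    have hL : 0 < 2 * Real.log n := by linarith
    have hn0 : (0 : ℝ) < n := by linarith
    have h1 : 1 ≤ n / (2 * Real.log n) := by rw [le_div_iff₀ hL]; linarith
    have hX1 : 1 ≤ X n := Real.one_le_rpow h1 (by positivity)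
    have hXd : X n ^ d = n / (2 * Real.log n) := Real.rpow_inv_natCast_pow (by linarith) hd0
    have hK1 : 0 < K n := Nat.floor_pos.2 hX1
    have hK1' : (1 : ℝ) ≤ K n := by exact_mod_cast hK1
    have hKX : (K n : ℝ) ≤ X n := Nat.floor_le (by linarith)
    have hXK : X n ≤ 2 * K n := by linarith [Nat.lt_floor_add_one (X n)]
    refine ⟨hn.1, hn0, hK1, ?_, ?_⟩
    · rw [← hXd]
      gcongr
    · calc (1 / K n : ℝ) ^ d ≤ (2 / X n) ^ d := by
            refine pow_le_pow_left₀ (by positivity) ?_ d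
            rw [div_le_div_iff₀ (by linarith) (by linarith)]
            linarith
        _ = _ := by rw [div_pow, hXd, div_div_eq_mul_div, mul_div_assoc]
  refine ⟨fun n => d / K n, ?_, ?_⟩
  · filter_upwards [hfacts] with n hn
    have := hn.2.2.1
    positivity
  have hlim : Tendsto (fun n : ℕ => ENNReal.ofReal (n : ℝ)⁻¹ + ENNReal.ofReal (n : ℝ)⁻¹) atTop
      (𝓝 0) := by
    have h : Tendsto (fun n : ℕ => ENNReal.ofReal (n : ℝ)⁻¹) atTop (𝓝 0) := by
      simpa using ENNReal.tendsto_ofReal (tendsto_inv_atTop_zero.comp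
        (tendsto_natCast_atTop_atTop (R := ℝ)))
    simpa using h.add h
  refine withHighProbability_of_compl_le hlim ?_
  filter_upwards [hfacts, eventually_mul_log_le_exp (2 * (16 * d : ℝ) ^ d) b] with n hn hexp
  obtain ⟨hL, hn0, hK0, hKd, hKi⟩ := hn
  have hK0' : (0 : ℝ) < K n := by exact_mod_cast hK0
  have hnexp : n * Real.exp (-(2 * Real.log n)) = (n : ℝ)⁻¹ := by
    rw [show -(2 * Real.log n) = -Real.log n + -Real.log n by ring, Real.exp_add, Real.exp_neg,
      Real.exp_log hn0, mul_inv_cancel_left₀ hn0.ne']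
  set y := Real.log n ^ (((b + 1 : ℕ) : ℝ)⁻¹) with hy
  set t := ⌈y⌉₊ with ht
  have hy0 : 0 ≤ y := by positivity
  have hyt : y ≤ t := Nat.le_ceil y
  have hytL : Real.log n ≤ (t : ℝ) ^ (b + 1) := by
    rw [← Real.rpow_inv_natCast_pow (show 0 ≤ Real.log n by linarith) (show b + 1 ≠ 0 by omega)]
    exact pow_le_pow_left₀ hy0 hyt _
  -- density
  have hE1 : K n ^ d * Real.exp (-(n * (1 / K n : ℝ) ^ d)) ≤ (n : ℝ)⁻¹ := by
    rw [← hnexp]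
    refine mul_le_mul (hKd.trans (div_le_self hn0.le (by linarith))) (Real.exp_le_exp.2 ?_)
      (Real.exp_nonneg _) hn0.le
    rw [neg_le_neg_iff, div_pow, one_pow, mul_one_div, le_div_iff₀ (by positivity)]
    rw [le_div_iff₀ (by linarith)] at hKd
    linarith
  -- sparsity
  set ρ := 4 * (d / K n : ℝ) / 2 ^ (6 * t) with hρ
  have hρ0 : 0 ≤ ρ := by positivity
  have hE2' : n * (2 * ρ) ^ d ≤ Real.exp (-(2 * t)) := by
    -- The factor `6` in the exponent serves here: `2 ^ 6 ≥ exp 3`. One `exp t` of the gain then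
    -- pays for the `log n` factor, leaving `exp (-2 * t)`.
    have h2 : ((1 / 2 : ℝ) ^ (6 * t)) ≤ Real.exp (-(3 * t)) := by
      rw [pow_mul, show -(3 * (t : ℝ)) = t * (-3) by ring, Real.exp_nat_mul]
      refine pow_le_pow_left₀ (by positivity) ?_ t
      rw [Real.exp_neg, one_div, inv_pow, inv_le_inv₀ (by norm_num) (Real.exp_pos _),
        show (3 : ℝ) = ((3 : ℕ) : ℝ) * 1 by norm_num, Real.exp_nat_mul]
      calc Real.exp 1 ^ 3 ≤ 3 ^ 3 := pow_le_pow_left₀ (Real.exp_nonneg _)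
            (by linarith [Real.exp_one_lt_d9]) 3
        _ ≤ _ := by norm_num
    have h3 : (2 * ρ) ^ d = (8 * d : ℝ) ^ d * (1 / K n) ^ d * ((1 / 2) ^ (6 * t)) ^ d := by
      rw [← mul_pow, ← mul_pow, hρ, one_div_pow]
      congr 1
      field_simp
      ring
    have h4 : (((1 / 2 : ℝ) ^ (6 * t)) ^ d) ≤ (1 / 2) ^ (6 * t) :=
      pow_le_of_le_one (by positivity) (pow_le_one₀ (by norm_num) (by norm_num)) hd0
    calc n * (2 * ρ) ^ d ≤ n * ((8 * d : ℝ) ^ d * (2 ^ d * (2 * Real.log n / n)) *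
          Real.exp (-(3 * t))) := by
          rw [h3]
          gcongr
          exact h4.trans h2
      _ = (2 * (16 * d : ℝ) ^ d * Real.log n) * Real.exp (-(3 * t)) := by
          rw [show (16 * d : ℝ) = 8 * d * 2 by ring, mul_pow (8 * d : ℝ) 2 d]
          field_simp
      _ ≤ Real.exp t * Real.exp (-(3 * t)) := by
          gcongr
          exact hexp.trans (Real.exp_le_exp.2 hyt)
      _ = _ := by rw [← Real.exp_add]; congr 1; ring
  -- Raising to the power `t ^ b` gives `exp (-2 * t ^ (b + 1))`, and `t ^ (b + 1) ≥ log n`.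
  have hE2 : n * (n * (2 * ρ) ^ d) ^ t ^ b ≤ (n : ℝ)⁻¹ := by
    rw [← hnexp]
    refine mul_le_mul_of_nonneg_left ?_ hn0.le
    refine (pow_le_pow_left₀ (by positivity) hE2' _).trans ?_
    rw [← Real.exp_nat_mul, Real.exp_le_exp]
    push_cast
    rw [pow_succ] at hytL
    linarith
  have hsub : {x : Fin n → Pt d | ¬ (Function.Injective x ∧ (∀ i, x i ∈ unitCube d) ∧
      (∀ p ∈ unitCube d, ∃ i, dist p (x i) ≤ d / K n) ∧
      ∀ i, (Finset.univ.filter fun j => dist (x j) (x i) ≤ ρ).card ≤ t ^ b)} ⊆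
      ({x | ¬ Function.Injective x} ∪ {x | ¬ ∀ i, x i ∈ unitCube d}) ∪
      ({x | ¬ ∀ p ∈ unitCube d, ∃ i, dist p (x i) ≤ d / K n} ∪
        {x | ∃ i, t ^ b < (Finset.univ.filter fun j => dist (x j) (x i) ≤ ρ).card}) := by
    intro x hx
    by_contra hcon
    simp only [Set.mem_union, Set.mem_ofPred_eq, not_or, not_not, not_exists, not_lt] at hcon
    exact hx ⟨hcon.1.1, hcon.1.2, hcon.2.1, hcon.2.2⟩
  refine (measure_mono hsub).trans ((measure_union_le _ _).trans ?_)
  refine (add_le_add (measure_union_le _ _) (measure_union_le _ _)).trans ?_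
  rw [uniformPoints_not_injective hd, uniformPoints_not_mem_cube, zero_add, zero_add]
  refine add_le_add ((uniformPoints_not_dense_le hK0).trans (ENNReal.ofReal_le_ofReal hE1))
    ((uniformPoints_crowded_le d n (t ^ b) ρ).trans ?_)
  refine le_trans (le_of_eq ?_) (ENNReal.ofReal_le_ofReal hE2)
  rw [← ENNReal.ofReal_natCast, ← ENNReal.ofReal_pow (by positivity), ← ENNReal.ofReal_mul hn0.le,
    ← ENNReal.ofReal_pow (by positivity), ← ENNReal.ofReal_mul hn0.le]

theorem eventually_ceil_log_rpow_le (b : ℕ) : ∀ᶠ n : ℕ in atTop,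
    2 ≤ ⌈Real.log n ^ (((b + 1 : ℕ) : ℝ)⁻¹)⌉₊ ∧
      (⌈Real.log n ^ (((b + 1 : ℕ) : ℝ)⁻¹)⌉₊ : ℝ) ≤ 2 * Real.log n ^ (((b + 1 : ℕ) : ℝ)⁻¹) := by
  filter_upwards [(tendsto_log_rpow (a := ((b + 1 : ℕ) : ℝ)⁻¹) (by positivity)).eventually_ge_atTop 2]
    with n hn
  refine ⟨?_, ?_⟩
  · exact_mod_cast hn.trans (Nat.le_ceil _)
  · linarith [Nat.ceil_lt_add_one (show 0 ≤ Real.log n ^ (((b + 1 : ℕ) : ℝ)⁻¹) by linarith)]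

theorem exists_mst_interference_whp {d : ℕ} (hd : 1 ≤ d) : ∃ C : ℝ,
    WithHighProbability d fun n x => ∀ G : SimpleGraph (Fin n), IsMST x G →
      (graphInterference x G : ℝ) ≤ C * Real.log n ^ (1 / 2 : ℝ) := by
  obtain ⟨M, hM⟩ := exists_mst_interference_bound d
  obtain ⟨lam, hlam, hgood⟩ := exists_withHighProbability_dense_sparse hd 1
  -- Here `s = 6 * t` and `m = t`; the final `2` pays for the ceiling in `t`.
  refine ⟨(M * 6 + 1) * 2, hgood.mono ?_⟩
  filter_upwards [hlam, eventually_ceil_log_rpow_le 1] with n hl ht x ⟨_, hx, hdense, hsparse⟩ G hG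
  have h := hM x (lam n) _ _ hl hx hdense hsparse G hG
  have h' : (graphInterference x G : ℝ) ≤ _ := Nat.cast_le.2 h
  refine h'.trans ?_
  push_cast at ht ⊢
  rw [show (1 / 2 : ℝ) = (1 + 1)⁻¹ by norm_num, pow_one]
  nlinarith [ht.2, (Nat.cast_nonneg M : (0 : ℝ) ≤ M)]

theorem exists_pointInterference_whp {d : ℕ} (hd : 1 ≤ d) : ∃ C : ℝ, 0 ≤ C ∧
    WithHighProbability d fun n x =>
      (pointInterference x : ℝ) ≤ C * Real.log n ^ (1 / 3 : ℝ) := by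
  obtain ⟨C, hC⟩ := exists_pointInterference_bound d
  obtain ⟨lam, hlam, hgood⟩ := exists_withHighProbability_dense_sparse hd 2
  -- The `7` comes from `s + t = 6 * t + t`.
  refine ⟨C * 7 * 2, by positivity, hgood.mono ?_⟩
  filter_upwards [hlam, eventually_ceil_log_rpow_le 2, eventually_gt_atTop 0]
    with n hl ht hn x ⟨hinj, hx, hdense, hsparse⟩
  have h := hC x (lam n) _ _ hn hinj hl ht.1 hx hdense hsparse
  have h' : (pointInterference x : ℝ) ≤ _ := Nat.cast_le.2 h
  refine h'.trans ?_
  push_cast at ht ⊢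
  rw [show (1 / 3 : ℝ) = (2 + 1)⁻¹ by norm_num]
  nlinarith [ht.2, (Nat.cast_nonneg C : (0 : ℝ) ≤ C)]

theorem theorem1 (d : ℕ) (hd : 1 ≤ d) :
    (∃ C : ℝ, WithHighProbability d fun n x =>
      ∀ G : SimpleGraph (Fin n), IsMST x G →
        (graphInterference x G : ℝ) ≤ C * Real.log n ^ (1 / 2 : ℝ)) ∧
    (d = 1 ∨ d = 2 → ∃ C : ℝ, WithHighProbability d fun n x =>
      (pointInterference x : ℝ) ≤ C * Real.log n ^ (1 / 3 : ℝ)) ∧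
    (3 ≤ d → ∃ C : ℝ, WithHighProbability d fun n x =>
      (pointInterference x : ℝ) ≤
        C * (Real.log n ^ (1 / 3 : ℝ) * Real.log (Real.log n) ^ (1 / 2 : ℝ))) := by
  obtain ⟨C, hC0, hC⟩ := exists_pointInterference_whp hd
  refine ⟨exists_mst_interference_whp hd, fun _ => ⟨C, hC⟩, fun _ => ⟨C, hC.mono ?_⟩⟩
  filter_upwards [tendsto_log_natCast.eventually_ge_atTop 0,
    (Real.tendsto_log_atTop.comp tendsto_log_natCast).eventually_ge_atTop 1] with n h0 h1 x hx
  refine hx.trans (mul_le_mul_of_nonneg_left ?_ hC0)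
  -- Once `log (log n) ≥ 1`, the extra factor only weakens the bound already proved in all
  -- dimensions.
  exact le_mul_of_one_le_right (by positivity) (Real.one_le_rpow h1 (by norm_num))
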